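/- Let $\lambda_1,\lambda_2,\mu_1,\mu_2>0$, let $\eta_1,\eta_2\ge 0$ with $\eta_1+\eta_2>0$, let $p\in[0,1]$ and $j\in\mathbb N=\{1,2,\dots\}$. Consider the M/M/1 queue in two randomly switching environments: in environment $i\in\{1,2\}$ customers arrive at rate $\lambda_i$ and are served at rate $\mu_i$, and the environment switches to the other one at rate $\eta_i$. Let $\widetilde{\bf N}(t)=(\widetilde N(t),\mathscr E(t))$, $t\ge 0$, be the continuous-time Markov chain on $\mathbb N_0\times\{1,2\}$ whose transition rates are obtained from those of this queue by removing all transitions out of $(0,1)$ and $(0,2)$ (which become absorbing), with $\widetilde{\bf N}(0)=(j,1)$ with probability $p$ and $\widetilde{\bf N}(0)=(j,2)$ with probability $1-p$. Put $\gamma_{n,i}(t)=\mathbb P[\widetilde{\bf N}(t)=(n,i)]$. For $i=1,2$, $k,n\in\mathbb N$ and $t\ge0$ let $$\widehat\alpha^{(i)}_{k,n}(t)=e^{-(\lambda_i+\mu_i)t}\Big(\frac{\lambda_i}{\mu_i}\Big)^{(n-k)/2}\Big[I_{n-k}\big(2t\sqrt{\lambda_i\mu_i}\big)-I_{n+k}\big(2t\sqrt{\lambda_i\mu_i}\big)\Big],$$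 where $I_\nu$ is the modified Bessel function of the first kind (these are the transition probabilities avoiding state $0$ of the M/M/1 queue with arrival rate $\lambda_i$ and service rate $\mu_i$). If $\eta_2=0$, then for all $n\in\mathbb N$ and $t>0$ $$\gamma_{n,1}(t)=p\,e^{-\eta_1t}\,\widehat\alpha^{(1)}_{j,n}(t),$$ $$\gamma_{n,2}(t)=(1-p)\,\widehat\alpha^{(2)}_{j,n}(t)+\eta_1\,p\sum_{k=1}^{\infty}\int_0^t e^{-\eta_1\tau}\,\widehat\alpha^{(1)}_{j,k}(\tau)\,\widehat\alpha^{(2)}_{k,n}(t-\tau)\,d\tau,$$ where the integrals exist and the series converges; moreover, for $i=1,2$ and $t>0$, $$\widehat\alpha^{(i)}_{j,1}(t)=\frac{j}{\mu_i t}\,e^{-(\lambda_i+\mu_i)t}\Big(\frac{\mu_i}{\lambda_i}\Big)^{j/2}I_j\big(2t\sqrt{\lambda_i\mu_i}\big).$$ -/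

import Mathlib

open MeasureTheory
open scoped NNReal

/-! ### Continuous-time Markov chains on a countable state space, given by their transition rates -/

/-- The conservative `q`-matrix with off-diagonal entries `r x y` (the rate of the transitions
from `x` to `y ≠ x`): the diagonal entry is minus the total rate out of `x`. -/
noncomputable def rateGenerator {S : Type*} [DecidableEq S] (r : S → S → ℝ) (x y : S) : ℝ :=
  if x = y then -∑' z, (if z = x then 0 else r x z) else r x y

/-- `P t x y`, `t ≥ 0`, is a standard stochastic transition function with `q`-matrix `Q`:
every row is a probability distribution, `P 0` is the identity, the Chapman-Kolmogorov equations
hold, and the right derivative of `P` at time `0` is `Q`. -/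
structure IsTransitionFunction {S : Type*} [DecidableEq S]
    (Q : S → S → ℝ) (P : ℝ → S → S → ℝ) : Prop where
  nonneg : ∀ t, 0 ≤ t → ∀ x y, 0 ≤ P t x y
  hasSum_one : ∀ t, 0 ≤ t → ∀ x, HasSum (fun y => P t x y) 1
  zero : ∀ x y, P 0 x y = if x = y then 1 else 0
  chapman_kolmogorov : ∀ s t, 0 ≤ s → 0 ≤ t → ∀ x y,
    HasSum (fun z => P s x z * P t z y) (P (s + t) x y)
  hasDerivWithinAt_zero : ∀ x y,
    HasDerivWithinAt (fun t => P t x y) (Q x y) (Set.Ici 0) 0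

/-- `X` is, under `ℙ`, a time-homogeneous continuous-time Markov chain with `q`-matrix `Q` and
initial distribution `init`: its finite-dimensional distributions are
`init x₀ * P (t₁ - t₀) x₀ x₁ * ⋯ * P (tₘ - tₘ₋₁) xₘ₋₁ xₘ` for `0 = t₀ ≤ t₁ ≤ ⋯ ≤ tₘ`,
where `P` is a transition function with `q`-matrix `Q`. -/
structure IsMarkovChain {S : Type*} [DecidableEq S] (Q : S → S → ℝ) (init : S → ℝ)
    {Ω : Type*} [MeasurableSpace Ω] (ℙ : Measure Ω) (X : ℝ≥0 → Ω → S) : Prop where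
  measurableSet_eq : ∀ t x, MeasurableSet {ω | X t ω = x}
  exists_transitionFunction : ∃ P : ℝ → S → S → ℝ, IsTransitionFunction Q P ∧
    ∀ (m : ℕ) (t : Fin (m + 1) → ℝ≥0) (x : Fin (m + 1) → S), Monotone t → t 0 = 0 →
      ℙ.real {ω | ∀ k, X (t k) ω = x k} =
        init (x 0) * ∏ k : Fin m,
          P ((t k.succ : ℝ) - (t k.castSucc : ℝ)) (x k.castSucc) (x k.succ)

/-! ### The M/M/1 queue in two switching environments -/

/-- The two operational environments. -/
inductive Env where
  | one : Env
  | two : Env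
  deriving DecidableEq

/-- Transition rates of the M/M/1 queue in the two environments, with states
(number of customers, environment): in environment `i` customers arrive at rate `lam i`, are served
at rate `mu i`, and the environment changes at rate `eta i`. -/
def queueRate (lam mu eta : Env → ℝ) (x y : ℕ × Env) : ℝ :=
  if y.2 = x.2 then
    if y.1 = x.1 + 1 then lam x.2
    else if x.1 = y.1 + 1 then mu x.2
    else 0
  else if y.1 = x.1 then eta x.2
  else 0

/-- The rates of the queue after removing all transitions out of `(0, i)`, so that the states
with no customers are absorbing. -/
def absorbedRate (lam mu eta : Env → ℝ) (x y : ℕ × Env) : ℝ :=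
  if x.1 = 0 then 0 else queueRate lam mu eta x y

/-- The initial distribution: `(j, 1)` with probability `p` and `(j, 2)` with
probability `1 - p`. -/
def initialLaw (j : ℕ) (p : ℝ) (x : ℕ × Env) : ℝ :=
  if x.1 = j then
    match x.2 with
    | Env.one => p
    | Env.two => 1 - p
  else 0

/-! ### Bessel functions and zero-avoiding transition probabilities -/

/-- The modified Bessel function of the first kind of integer order `ν`,
`I_ν(z) = ∑ₖ (z/2)^(2k+ν) / (k! Γ(k+ν+1))`. At the poles of `Γ` Mathlib has `Γ = 0` and
`a / 0 = 0`, so that the terms with `k + ν + 1 ≤ 0` vanish, in agreement with `1/Γ = 0` there. -/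
noncomputable def besselI (ν : ℤ) (z : ℝ) : ℝ :=
  ∑' k : ℕ, (z / 2) ^ (2 * (k : ℤ) + ν) /
    ((k.factorial : ℝ) * Real.Gamma ((k : ℝ) + (ν : ℝ) + 1))

/-- The transition probabilities, avoiding state `0`, of the M/M/1 queue with arrival rate `l` and
service rate `m`, from `j ≥ 1` to `n ≥ 1` in time `t`. -/
noncomputable def zeroAvoidingProb (l m : ℝ) (j n : ℕ) (t : ℝ) : ℝ :=
  Real.exp (-(l + m) * t) * (l / m) ^ (((n : ℝ) - (j : ℝ)) / 2) *
    (besselI ((n : ℤ) - (j : ℤ)) (2 * t * Real.sqrt (l * m)) -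
      besselI ((n : ℤ) + (j : ℤ)) (2 * t * Real.sqrt (l * m)))

/-! ### Modified Bessel functions of integer order -/

/-! Conditioning on the start (`measureReal_eq_of_markov`) reduces everything to the transition
function `P` of the absorbed chain. Each state has finitely many neighbours, so the derivative of
`P` at time `0` and Chapman-Kolmogorov give the backward equations at all times
(`hasDerivWithinAt_backward`). The rates are bounded, so bounded solutions with given initial data
are unique (`eq_zero_of_deriv_right_bound`).

The Bessel expressions solve the same equations, vanish at `0`, and for a fixed final state are
bounded uniformly in the initial state (`abs_zeroAvoidingProb_le`). Since `eta Env.two = 0`,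
environment two is never left: `P` from two to one vanishes, from two to two it is the Bessel
expression, and from one to one it is that expression damped by `exp (-η₁ t)`, a switch acting as
killing.

From one to two, the backward equations carry the source `η₁` times the known two-to-two
probabilities. `hasSum_duhamel` solves them by pairing with the killed forward equation, which is
read off the explicit Bessel formula rather than derived for `P`. The form with final state `1` is
the three-term Bessel recurrence `besselI_sub_besselI`. -/

theorem hasSum_of_hasSum_nat_add {f : ℕ → ℝ} {a : ℝ} (m : ℕ) (h : HasSum (fun k => f (k + m)) a)
    (h0 : ∑ k ∈ Finset.range m, f k = 0) : HasSum f a := by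
  have := (hasSum_nat_add_iff m).1 h
  rwa [h0, add_zero] at this

theorem summable_bessel_series (m : ℕ) (y : ℝ) :
    Summable fun k : ℕ => y ^ (2 * k + m) / ((k.factorial : ℝ) * ((k + m).factorial : ℝ)) := by
  have h : Summable fun k : ℕ => |y| ^ m * ((y ^ 2) ^ k / (k.factorial : ℝ)) :=
    (Real.summable_pow_div_factorial (y ^ 2)).mul_left _
  refine Summable.of_norm_bounded h fun k => ?_
  have h1 : (1 : ℝ) ≤ ((k + m).factorial : ℝ) := by exact_mod_cast Nat.factorial_pos _
  have h2 : (0 : ℝ) < (k.factorial : ℝ) := by exact_mod_cast Nat.factorial_pos _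
  rw [norm_div, norm_pow, Real.norm_eq_abs, Real.norm_eq_abs,
    abs_of_pos (by positivity : (0 : ℝ) < (k.factorial : ℝ) * ((k + m).factorial : ℝ)),
    pow_add, pow_mul, sq_abs, mul_comm, mul_div_assoc]
  gcongr
  nlinarith

theorem besselI_natCast (m : ℕ) (z : ℝ) :
    besselI (m : ℤ) z =
      ∑' k : ℕ, (z / 2) ^ (2 * k + m) / ((k.factorial : ℝ) * ((k + m).factorial : ℝ)) := by
  unfold besselI
  refine tsum_congr fun k => ?_
  have h : (k : ℝ) + ((m : ℤ) : ℝ) + 1 = ((k + m : ℕ) : ℝ) + 1 := by push_cast; ring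
  rw [h, Real.Gamma_nat_eq_factorial]
  congr 1

theorem hasSum_besselI_natCast (m : ℕ) (z : ℝ) :
    HasSum (fun k : ℕ => (z / 2) ^ (2 * k + m) / ((k.factorial : ℝ) * ((k + m).factorial : ℝ)))
      (besselI (m : ℤ) z) := by
  rw [besselI_natCast]
  exact (summable_bessel_series m (z / 2)).hasSum

/-- For `ν = -m` the first `m` terms vanish at the poles of `Γ`; shifting the rest by `m` gives the
series of `I_m`. -/
theorem besselI_neg (ν : ℤ) (z : ℝ) : besselI (-ν) z = besselI ν z := by
  suffices h : ∀ m : ℕ, besselI (-(m : ℤ)) z = besselI (m : ℤ) z by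
    obtain ⟨m, rfl | rfl⟩ := ν.eq_nat_or_neg
    · exact h m
    · rw [neg_neg]; exact (h m).symm
  intro m
  refine HasSum.tsum_eq ?_
  have h0 : ∑ k ∈ Finset.range m, (z / 2) ^ (2 * (k : ℤ) + -(m : ℤ)) /
      ((k.factorial : ℝ) * Real.Gamma ((k : ℝ) + ((-(m : ℤ) : ℤ) : ℝ) + 1)) = 0 := by
    refine Finset.sum_eq_zero fun k hk => ?_
    have hk : k + 1 ≤ m := Finset.mem_range.1 hk
    have : (k : ℝ) + ((-(m : ℤ) : ℤ) : ℝ) + 1 = -((m - (k + 1) : ℕ) : ℝ) := by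
      push_cast [Nat.cast_sub hk]; ring
    rw [this, Real.Gamma_neg_nat_eq_zero]
    simp
  refine hasSum_of_hasSum_nat_add m ?_ h0
  refine (hasSum_besselI_natCast m z).congr_fun fun k => ?_
  have h1 : ((k + m : ℕ) : ℝ) + ((-(m : ℤ) : ℤ) : ℝ) + 1 = (k : ℝ) + 1 := by push_cast; ring
  have h2 : 2 * ((k + m : ℕ) : ℤ) + -(m : ℤ) = ((2 * k + m : ℕ) : ℤ) := by push_cast; ring
  rw [h1, h2, Real.Gamma_nat_eq_factorial, zpow_natCast, mul_comm (k.factorial : ℝ)]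

theorem besselI_zero_right (ν : ℤ) : besselI ν 0 = if ν = 0 then 1 else 0 := by
  have key : ∀ m : ℕ, besselI (m : ℤ) 0 = if (m : ℤ) = 0 then 1 else 0 := by
    intro m
    rw [besselI_natCast, tsum_eq_single 0]
    · rcases m with _ | m <;> simp
      omega
    · intro k hk
      rw [zero_div, zero_pow (by omega), zero_div]
  obtain ⟨m, rfl | rfl⟩ := ν.eq_nat_or_neg
  · exact key m
  · rw [besselI_neg, key]; simp

/-- The part of the series of `I_m` whose terms carry the weight `k + m + 1` gives `I_m`. -/
theorem hasSum_bessel_weight (m : ℕ) (z : ℝ) :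
    HasSum (fun k : ℕ => ((k : ℝ) + m + 1) *
      ((z / 2) ^ (2 * k + m) / ((k.factorial : ℝ) * ((k + (m + 1)).factorial : ℝ))))
      (besselI (m : ℤ) z) := by
  refine (hasSum_besselI_natCast m z).congr_fun fun k => ?_
  rw [← add_assoc, Nat.factorial_succ]
  have h1 : ((k + m).factorial : ℝ) ≠ 0 := by exact_mod_cast Nat.factorial_ne_zero _
  have h2 : (k.factorial : ℝ) ≠ 0 := by exact_mod_cast Nat.factorial_ne_zero _
  have h3 : (k : ℝ) + m + 1 ≠ 0 := by positivity
  push_cast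
  field_simp

/-- The factor `k` cancels against `k!`, and a shift by one raises the order by two. Adding this to
`hasSum_bessel_weight` yields the derivative of `I_(m+1)`; subtracting leaves the constant weight `m
+ 1`, hence the recurrence. -/
theorem hasSum_bessel_index (m : ℕ) (z : ℝ) :
    HasSum (fun k : ℕ => (k : ℝ) *
      ((z / 2) ^ (2 * k + m) / ((k.factorial : ℝ) * ((k + (m + 1)).factorial : ℝ))))
      (besselI ((m + 2 : ℕ) : ℤ) z) := by
  refine hasSum_of_hasSum_nat_add 1 ?_ (by simp)
  refine (hasSum_besselI_natCast (m + 2) z).congr_fun fun k => ?_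
  have e1 : 2 * (k + 1) + m = 2 * k + (m + 2) := by ring
  have e2 : k + 1 + (m + 1) = k + (m + 2) := by ring
  rw [e1, e2, Nat.factorial_succ]
  have h1 : ((k + (m + 2)).factorial : ℝ) ≠ 0 := by exact_mod_cast Nat.factorial_ne_zero _
  have h2 : (k.factorial : ℝ) ≠ 0 := by exact_mod_cast Nat.factorial_ne_zero _
  have h3 : (k : ℝ) + 1 ≠ 0 := by positivity
  push_cast
  field_simp

/-- For positive order `m + 1` the exponent splits as `2k + m + 1 = (k + m + 1) + k`. For order `0`
both neighbours equal `I_1` by symmetry. -/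
theorem hasSum_deriv_bessel_series (m : ℕ) (z : ℝ) :
    HasSum (fun k : ℕ => ((2 * k + m : ℕ) : ℝ) * (z / 2) ^ (2 * k + m - 1) * (1 / 2) /
      ((k.factorial : ℝ) * ((k + m).factorial : ℝ)))
      ((besselI ((m : ℤ) - 1) z + besselI ((m : ℤ) + 1) z) / 2) := by
  rcases m with _ | m
  · have h : besselI (((0 : ℕ) : ℤ) - 1) z = besselI (((0 : ℕ) : ℤ) + 1) z := by
      rw [← besselI_neg]; norm_num
    rw [h, add_self_div_two]
    refine hasSum_of_hasSum_nat_add 1 ?_ (by simp)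
    · refine (hasSum_besselI_natCast 1 z).congr_fun fun k => ?_
      have e1 : 2 * (k + 1) + 0 - 1 = 2 * k + 1 := by omega
      rw [e1, add_zero, Nat.factorial_succ]
      have h2 : (k.factorial : ℝ) ≠ 0 := by exact_mod_cast Nat.factorial_ne_zero _
      have h3 : (k : ℝ) + 1 ≠ 0 := by positivity
      push_cast
      field_simp
  · have h1 : (((m + 1 : ℕ) : ℤ) - 1) = (m : ℤ) := by push_cast; ring
    have h2 : (((m + 1 : ℕ) : ℤ) + 1) = ((m + 2 : ℕ) : ℤ) := by push_cast; ring
    rw [h1, h2]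
    refine (((hasSum_bessel_weight m z).add (hasSum_bessel_index m z)).div_const 2).congr_fun
      fun k => ?_
    have e1 : 2 * k + (m + 1) - 1 = 2 * k + m := by omega
    rw [e1]
    push_cast
    ring

theorem hasDerivAt_besselI_natCast (m : ℕ) (z : ℝ) :
    HasDerivAt (besselI (m : ℤ))
      ((besselI ((m : ℤ) - 1) z + besselI ((m : ℤ) + 1) z) / 2) z := by
  have hfun : besselI (m : ℤ) = fun z => ∑' k : ℕ,
      (z / 2) ^ (2 * k + m) / ((k.factorial : ℝ) * ((k + m).factorial : ℝ)) :=
    funext (besselI_natCast m)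
  rw [hfun, ← (hasSum_deriv_bessel_series m z).tsum_eq]
  -- On this ball the differentiated terms are dominated by their values at `|z| + 1`, so
  -- differentiation under the sum is allowed.
  have hz : z ∈ Metric.ball (0 : ℝ) (|z| + 1) := by simp
  refine hasDerivAt_tsum_of_isPreconnected (hasSum_deriv_bessel_series m (|z| + 1)).summable
    Metric.isOpen_ball (convex_ball _ _).isPreconnected
    (g := fun k z => (z / 2) ^ (2 * k + m) / ((k.factorial : ℝ) * ((k + m).factorial : ℝ)))
    (g' := fun k z => ((2 * k + m : ℕ) : ℝ) * (z / 2) ^ (2 * k + m - 1) * (1 / 2) /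
      ((k.factorial : ℝ) * ((k + m).factorial : ℝ))) ?_ ?_ hz
    (hasSum_besselI_natCast m z).summable hz
  · intro k y _
    exact (((hasDerivAt_id y).div_const 2).pow (2 * k + m)).div_const _
  · intro k y hy
    have hy' : |y| ≤ |z| + 1 := by simpa using (Metric.mem_ball.1 hy).le
    rw [norm_div, norm_mul, norm_mul, norm_pow, norm_div]
    simp only [Real.norm_eq_abs, Nat.abs_cast, abs_mul, abs_two, abs_one, abs_div]
    gcongr

theorem hasDerivAt_besselI (ν : ℤ) (z : ℝ) :
    HasDerivAt (besselI ν) ((besselI (ν - 1) z + besselI (ν + 1) z) / 2) z := by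
  obtain ⟨m, rfl | rfl⟩ := ν.eq_nat_or_neg
  · exact hasDerivAt_besselI_natCast m z
  · have h1 : besselI (-(m : ℤ)) = besselI (m : ℤ) := funext (besselI_neg m)
    have h2 : besselI (-(m : ℤ) - 1) z = besselI ((m : ℤ) + 1) z := by
      rw [← besselI_neg]; congr 1; ring
    have h3 : besselI (-(m : ℤ) + 1) z = besselI ((m : ℤ) - 1) z := by
      rw [← besselI_neg]; congr 1; ring
    rw [h1, h2, h3, add_comm]
    exact hasDerivAt_besselI_natCast m z

theorem besselI_sub_besselI (m : ℕ) (z : ℝ) :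
    z * (besselI (m : ℤ) z - besselI ((m : ℤ) + 2) z) =
      2 * ((m : ℝ) + 1) * besselI ((m : ℤ) + 1) z := by
  have h := ((hasSum_bessel_weight m z).sub (hasSum_bessel_index m z)).mul_left z
  have h' := (hasSum_besselI_natCast (m + 1) z).mul_left (2 * ((m : ℝ) + 1))
  push_cast at h h'
  refine h.unique ?_
  refine h'.congr_fun fun k => ?_
  rw [← add_assoc (2 * k), pow_succ]
  ring

/-- The generating function bound for modified Bessel functions. -/
theorem abs_zpow_mul_besselI_le {b z : ℝ} (hb : 0 < b) (hz : 0 ≤ z) (ν : ℤ) :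
    |b ^ ν * besselI ν z| ≤ Real.exp (b * z / 2 + b⁻¹ * z / 2) := by
  have key : ∀ (m : ℕ) (c : ℝ), 0 < c →
      |c ^ m * besselI (m : ℤ) z| ≤ Real.exp (c * z / 2 + c⁻¹ * z / 2) := by
    intro m c hc
    have hs := (hasSum_besselI_natCast m z).mul_left (c ^ m)
    have hexp : HasSum (fun k : ℕ => Real.exp (c * z / 2) *
        ((c⁻¹ * z / 2) ^ k / (k.factorial : ℝ)))
        (Real.exp (c * z / 2) * Real.exp (c⁻¹ * z / 2)) := by
      have := NormedSpace.expSeries_div_hasSum_exp (c⁻¹ * z / 2)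
      rw [← Real.exp_eq_exp_ℝ] at this
      exact this.mul_left _
    -- Each term is one term of the series of `exp (c z / 2)` times one of `exp (c⁻¹ z / 2)`;
    -- bounding the former by its exponential leaves a single sum.
    have hterm : ∀ k : ℕ, c ^ m * ((z / 2) ^ (2 * k + m) /
        ((k.factorial : ℝ) * ((k + m).factorial : ℝ))) =
        (c * z / 2) ^ (k + m) / ((k + m).factorial : ℝ) *
          ((c⁻¹ * z / 2) ^ k / (k.factorial : ℝ)) := by
      intro k
      have hcc : c ^ k * c⁻¹ ^ k = 1 := by rw [← mul_pow, mul_inv_cancel₀ hc.ne', one_pow]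
      rw [div_mul_div_comm, mul_div_assoc c, mul_div_assoc c⁻¹, mul_pow, mul_pow,
        mul_comm ((k + m).factorial : ℝ), ← mul_div_assoc]
      congr 1
      rw [pow_add c, show 2 * k + m = (k + m) + k by ring, pow_add (z / 2) (k + m)]
      linear_combination (-(c ^ m * (z / 2) ^ (k + m) * (z / 2) ^ k)) * hcc
    have hnn : 0 ≤ c ^ m * besselI (m : ℤ) z := by
      refine hs.nonneg fun k => ?_
      positivity
    rw [abs_of_nonneg hnn, Real.exp_add]
    refine hasSum_le (fun k => ?_) hs hexp
    rw [hterm]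
    gcongr
    exact Real.pow_div_factorial_le_exp _ (by positivity) _
  obtain ⟨m, rfl | rfl⟩ := ν.eq_nat_or_neg
  · rw [zpow_natCast]; exact key m b hb
  · rw [besselI_neg, zpow_neg, zpow_natCast, ← inv_pow, add_comm]
    have := key m b⁻¹ (inv_pos.2 hb)
    rwa [inv_inv] at this

/-! ### The zero-avoiding transition probabilities -/

section ZeroAvoiding

variable {l m : ℝ}

/-- With the integer powers of `√(l / m)`, moving `j` or `n` by one multiplies by `√(l / m)` or its
inverse, which together with `√(l * m)` reproduces the rates `l` and `m`. -/
theorem zeroAvoidingProb_eq (hl : 0 < l) (hm : 0 < m) (j n : ℕ) (t : ℝ) :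
    zeroAvoidingProb l m j n t = Real.exp (-(l + m) * t) *
      (√(l / m) ^ ((n : ℤ) - j) * (besselI ((n : ℤ) - j) (2 * t * √(l * m)) -
        besselI ((n : ℤ) + j) (2 * t * √(l * m)))) := by
  have h : (l / m) ^ (((n : ℝ) - (j : ℝ)) / 2) = √(l / m) ^ ((n : ℤ) - (j : ℤ)) := by
    rw [Real.sqrt_eq_rpow, ← Real.rpow_intCast, ← Real.rpow_mul (by positivity)]
    push_cast
    congr 1
    ring
  rw [zeroAvoidingProb, h, mul_assoc]

theorem zeroAvoidingProb_zero_left (l m : ℝ) (n : ℕ) (t : ℝ) :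
    zeroAvoidingProb l m 0 n t = 0 := by
  simp [zeroAvoidingProb]

theorem zeroAvoidingProb_zero_right (l m : ℝ) (j : ℕ) (t : ℝ) :
    zeroAvoidingProb l m j 0 t = 0 := by
  simp [zeroAvoidingProb, besselI_neg]

theorem zeroAvoidingProb_time_zero (hl : 0 < l) (hm : 0 < m) {j : ℕ} (hj : 1 ≤ j) (n : ℕ) :
    zeroAvoidingProb l m j n 0 = if j = n then 1 else 0 := by
  rw [zeroAvoidingProb_eq hl hm]
  simp only [mul_zero, zero_mul, besselI_zero_right, Real.exp_zero, one_mul]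
  rw [if_neg (by omega : ¬ (n : ℤ) + j = 0), sub_zero]
  by_cases h : j = n
  · subst h; simp
  · rw [if_neg h, if_neg (by omega : ¬ (n : ℤ) - j = 0), mul_zero]

theorem sqrt_div_mul_sqrt_mul (hl : 0 < l) (hm : 0 < m) : √(l / m) * √(l * m) = l := by
  rw [← Real.sqrt_mul (by positivity), show l / m * (l * m) = l * l by field_simp,
    Real.sqrt_mul_self hl.le]

theorem inv_sqrt_div_mul_sqrt_mul (hl : 0 < l) (hm : 0 < m) :
    (√(l / m))⁻¹ * √(l * m) = m := by
  rw [← Real.sqrt_inv, inv_div, mul_comm l m, sqrt_div_mul_sqrt_mul hm hl]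

theorem sqrt_mul_eq_inv_mul (hl : 0 < l) (hm : 0 < m) : (√(l / m))⁻¹ * l = √(l * m) := by
  have hb : √(l / m) ≠ 0 := (Real.sqrt_pos.2 (by positivity)).ne'
  rw [inv_mul_eq_iff_eq_mul₀ hb, sqrt_div_mul_sqrt_mul hl hm]

theorem sqrt_mul_eq_mul (hl : 0 < l) (hm : 0 < m) : √(l / m) * m = √(l * m) := by
  have hb : √(l / m) ≠ 0 := (Real.sqrt_pos.2 (by positivity)).ne'
  exact ((inv_mul_eq_iff_eq_mul₀ hb).1 (inv_sqrt_div_mul_sqrt_mul hl hm)).symm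

theorem hasDerivAt_zeroAvoidingProb (hl : 0 < l) (hm : 0 < m) (j n : ℕ) (t : ℝ) :
    HasDerivAt (zeroAvoidingProb l m j n) (-(l + m) * zeroAvoidingProb l m j n t +
      Real.exp (-(l + m) * t) * (√(l / m) ^ ((n : ℤ) - j) * (√(l * m) *
        ((besselI ((n : ℤ) - j - 1) (2 * t * √(l * m)) +
          besselI ((n : ℤ) - j + 1) (2 * t * √(l * m))) -
        (besselI ((n : ℤ) + j - 1) (2 * t * √(l * m)) +
          besselI ((n : ℤ) + j + 1) (2 * t * √(l * m))))))) t := by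
  have hz : HasDerivAt (fun t : ℝ => 2 * t * √(l * m)) (2 * 1 * √(l * m)) t :=
    ((hasDerivAt_id t).const_mul 2).mul_const _
  have he : HasDerivAt (fun t : ℝ => Real.exp (-(l + m) * t))
      (Real.exp (-(l + m) * t) * (-(l + m) * 1)) t :=
    ((hasDerivAt_id t).const_mul _).exp
  have h1 := (hasDerivAt_besselI ((n : ℤ) - j) (2 * t * √(l * m))).comp t hz
  have h2 := (hasDerivAt_besselI ((n : ℤ) + j) (2 * t * √(l * m))).comp t hz
  have h := he.mul ((h1.sub h2).const_mul (√(l / m) ^ ((n : ℤ) - j)))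
  have hf : zeroAvoidingProb l m j n = fun t => Real.exp (-(l + m) * t) *
      (√(l / m) ^ ((n : ℤ) - j) * (besselI ((n : ℤ) - j) (2 * t * √(l * m)) -
        besselI ((n : ℤ) + j) (2 * t * √(l * m)))) := funext (zeroAvoidingProb_eq hl hm j n)
  rw [hf]
  refine h.congr_deriv ?_
  simp only [Pi.sub_apply, Function.comp_apply]
  ring

/-- The backward equation: differentiation in the initial state. -/
theorem hasDerivAt_zeroAvoidingProb_backward (hl : 0 < l) (hm : 0 < m) (j n : ℕ) (t : ℝ) :
    HasDerivAt (zeroAvoidingProb l m (j + 1) n)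
      (l * zeroAvoidingProb l m (j + 2) n t + m * zeroAvoidingProb l m j n t -
        (l + m) * zeroAvoidingProb l m (j + 1) n t) t := by
  have hb : √(l / m) ≠ 0 := (Real.sqrt_pos.2 (by positivity)).ne'
  refine (hasDerivAt_zeroAvoidingProb hl hm (j + 1) n t).congr_deriv ?_
  rw [zeroAvoidingProb_eq hl hm (j + 2), zeroAvoidingProb_eq hl hm j]
  push_cast
  rw [show (n : ℤ) - (j + 2) = n - (j + 1) - 1 by ring, show (n : ℤ) - j = n - (j + 1) + 1 by ring,
    show (n : ℤ) + (j + 2) = n + (j + 1) + 1 by ring, show (n : ℤ) + j = n + (j + 1) - 1 by ring,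
    zpow_sub_one₀ hb, zpow_add_one₀ hb]
  have e1 := sqrt_mul_eq_inv_mul hl hm
  have e2 := sqrt_mul_eq_mul hl hm
  generalize √(l / m) ^ ((n : ℤ) - (j + 1)) = B
  generalize besselI ((n : ℤ) - (j + 1) - 1) (2 * t * √(l * m)) = x1
  generalize besselI ((n : ℤ) - (j + 1) + 1) (2 * t * √(l * m)) = x2
  generalize besselI ((n : ℤ) + (j + 1) - 1) (2 * t * √(l * m)) = x3
  generalize besselI ((n : ℤ) + (j + 1) + 1) (2 * t * √(l * m)) = x4
  generalize Real.exp (-(l + m) * t) = E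
  linear_combination (-(E * B * (x1 - x4))) * e1 - E * B * (x2 - x3) * e2

/-- The forward equation: differentiation in the final state. -/
theorem hasDerivAt_zeroAvoidingProb_forward (hl : 0 < l) (hm : 0 < m) (j n : ℕ) (t : ℝ) :
    HasDerivAt (zeroAvoidingProb l m j (n + 1))
      (l * zeroAvoidingProb l m j n t + m * zeroAvoidingProb l m j (n + 2) t -
        (l + m) * zeroAvoidingProb l m j (n + 1) t) t := by
  have hb : √(l / m) ≠ 0 := (Real.sqrt_pos.2 (by positivity)).ne'
  refine (hasDerivAt_zeroAvoidingProb hl hm j (n + 1) t).congr_deriv ?_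
  rw [zeroAvoidingProb_eq hl hm j (n + 2), zeroAvoidingProb_eq hl hm j n]
  push_cast
  rw [show (n : ℤ) + 2 - j = n + 1 - j + 1 by ring, show (n : ℤ) - j = n + 1 - j - 1 by ring,
    show (n : ℤ) + 2 + j = n + 1 + j + 1 by ring, show (n : ℤ) + j = n + 1 + j - 1 by ring,
    zpow_sub_one₀ hb, zpow_add_one₀ hb]
  have e1 := sqrt_mul_eq_inv_mul hl hm
  have e2 := sqrt_mul_eq_mul hl hm
  generalize √(l / m) ^ ((n : ℤ) + 1 - j) = B
  generalize besselI ((n : ℤ) + 1 - j - 1) (2 * t * √(l * m)) = x1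
  generalize besselI ((n : ℤ) + 1 - j + 1) (2 * t * √(l * m)) = x2
  generalize besselI ((n : ℤ) + 1 + j - 1) (2 * t * √(l * m)) = x3
  generalize besselI ((n : ℤ) + 1 + j + 1) (2 * t * √(l * m)) = x4
  generalize Real.exp (-(l + m) * t) = E
  linear_combination (-(E * B * (x1 - x3))) * e1 - E * B * (x2 - x4) * e2

theorem continuous_zeroAvoidingProb (hl : 0 < l) (hm : 0 < m) (j n : ℕ) :
    Continuous (zeroAvoidingProb l m j n) :=
  continuous_iff_continuousAt.2 fun t => (hasDerivAt_zeroAvoidingProb hl hm j n t).continuousAt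

/-- A bound that is uniform in the initial state. -/
theorem abs_zeroAvoidingProb_le (hl : 0 < l) (hm : 0 < m) (j n : ℕ) {t : ℝ} (ht : 0 ≤ t) :
    |zeroAvoidingProb l m j n t| ≤ 1 + √(l / m) ^ (2 * (n : ℤ)) := by
  have hb : 0 < √(l / m) := Real.sqrt_pos.2 (by positivity)
  have hz : 0 ≤ 2 * t * √(l * m) := by positivity
  -- The choice `b = √(l / m)` makes the exponent of the generating function bound exactly cancel
  -- `exp (-(l + m) * t)`.
  have hexp : √(l / m) * (2 * t * √(l * m)) / 2 + (√(l / m))⁻¹ * (2 * t * √(l * m)) / 2 =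
      (l + m) * t := by
    linear_combination t * sqrt_div_mul_sqrt_mul hl hm + t * inv_sqrt_div_mul_sqrt_mul hl hm
  have h1 := abs_zpow_mul_besselI_le hb hz ((n : ℤ) - j)
  -- The order `-(n + j)` is used because `b ^ (n - j) = b ^ (2n) * b ^ (-(n + j))`; the remaining
  -- factor does not involve `j`.
  have h2 := abs_zpow_mul_besselI_le hb hz (-((n : ℤ) + j))
  rw [hexp] at h1 h2
  rw [besselI_neg] at h2
  rw [zeroAvoidingProb_eq hl hm, mul_sub, abs_mul, Real.abs_exp]
  have h3 : √(l / m) ^ ((n : ℤ) - j) = √(l / m) ^ (2 * (n : ℤ)) * √(l / m) ^ (-((n : ℤ) + j)) := by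
    rw [← zpow_add₀ hb.ne']; congr 1; ring
  have h4 : |√(l / m) ^ ((n : ℤ) - j) * besselI ((n : ℤ) + j) (2 * t * √(l * m))| ≤
      √(l / m) ^ (2 * (n : ℤ)) * Real.exp ((l + m) * t) := by
    rw [h3, mul_assoc, abs_mul, abs_of_pos (zpow_pos hb _)]
    gcongr
  have h5 : Real.exp (-(l + m) * t) * Real.exp ((l + m) * t) = 1 := by
    rw [← Real.exp_add, neg_mul, neg_add_cancel, Real.exp_zero]
  calc _ ≤ Real.exp (-(l + m) * t) *
        (Real.exp ((l + m) * t) + √(l / m) ^ (2 * (n : ℤ)) * Real.exp ((l + m) * t)) := by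
        gcongr
        exact (abs_sub _ _).trans (add_le_add h1 h4)
    _ = _ := by linear_combination (1 + √(l / m) ^ (2 * (n : ℤ))) * h5

theorem zeroAvoidingProb_one_right (hl : 0 < l) (hm : 0 < m) {j : ℕ} (hj : 1 ≤ j) {t : ℝ}
    (ht : 0 < t) :
    zeroAvoidingProb l m j 1 t = (j : ℝ) / (m * t) * Real.exp (-(l + m) * t) *
      (m / l) ^ ((j : ℝ) / 2) * besselI (j : ℤ) (2 * t * √(l * m)) := by
  obtain ⟨i, rfl⟩ : ∃ i, j = i + 1 := ⟨j - 1, by omega⟩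
  have hb : 0 < √(l / m) := Real.sqrt_pos.2 (by positivity)
  have hs : 0 < √(l * m) := Real.sqrt_pos.2 (by positivity)
  have hpow : (m / l) ^ (((i + 1 : ℕ) : ℝ) / 2) = √(l / m) ^ (-((i + 1 : ℕ) : ℤ)) := by
    rw [zpow_neg, ← inv_zpow, ← Real.sqrt_inv, inv_div, Real.sqrt_eq_rpow, ← Real.rpow_intCast,
      ← Real.rpow_mul (by positivity)]
    push_cast
    congr 1
    ring
  rw [zeroAvoidingProb_eq hl hm, hpow]
  have hrec := besselI_sub_besselI i (2 * t * √(l * m))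
  rw [show ((1 : ℕ) : ℤ) - ((i + 1 : ℕ) : ℤ) = -(i : ℤ) by push_cast; ring, besselI_neg,
    show ((1 : ℕ) : ℤ) + ((i + 1 : ℕ) : ℤ) = (i : ℤ) + 2 by push_cast; ring,
    show -(i : ℤ) = -((i + 1 : ℕ) : ℤ) + 1 by push_cast; ring, zpow_add_one₀ hb.ne']
  have e2 := sqrt_mul_eq_mul hl hm
  push_cast
  generalize √(l / m) ^ (-((i : ℤ) + 1)) = B
  generalize besselI (i : ℤ) (2 * t * √(l * m)) = x1 at *
  generalize besselI ((i : ℤ) + 2) (2 * t * √(l * m)) = x2 at *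
  generalize besselI ((i : ℤ) + 1) (2 * t * √(l * m)) = x3 at *
  generalize Real.exp (-(l + m) * t) = E
  rw [← e2] at hrec
  field_simp
  linear_combination E * B / 2 * hrec

end ZeroAvoiding

open Set Filter Topology

/-! ### Bounded solutions of linear systems -/

/-- A family of functions that is bounded uniformly in the index, vanishes initially, and whose
right derivatives are bounded by `C` times any uniform bound of the family, is zero. -/
theorem eq_zero_of_deriv_right_bound {ι : Type*} {d D : ι → ℝ → ℝ} {T M C : ℝ}
    (hM : 0 ≤ M) (hC : 0 ≤ C)
    (hcont : ∀ i, ContinuousOn (d i) (Ici 0))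
    (hderiv : ∀ i, ∀ t, 0 ≤ t → HasDerivWithinAt (d i) (D i t) (Ici t) t)
    (hzero : ∀ i, d i 0 = 0)
    (hbound : ∀ i, ∀ t ∈ Icc 0 T, |d i t| ≤ M)
    (hD : ∀ t, ∀ B, 0 ≤ t → 0 ≤ B → (∀ i, |d i t| ≤ B) → ∀ i, |D i t| ≤ C * B) :
    ∀ i, ∀ t ∈ Icc 0 T, d i t = 0 := by
  -- Iterated Grönwall: each pass through the derivative bound integrates the previous estimate, and
  -- `(C t)^n / n!` tends to `0`.
  have key : ∀ n : ℕ, ∀ i, ∀ t ∈ Icc 0 T, |d i t| ≤ M * ((C * t) ^ n / (n.factorial : ℝ)) := by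
    intro n
    induction n with
    | zero => intro i t ht; simpa using hbound i t ht
    | succ n ih =>
      intro i
      have hB : ∀ x : ℝ, HasDerivAt (fun t => M * ((C * t) ^ (n + 1) / ((n + 1).factorial : ℝ)))
          (C * (M * ((C * x) ^ n / (n.factorial : ℝ)))) x := by
        intro x
        refine (((((hasDerivAt_id x).const_mul C).pow (n + 1)).div_const _).const_mul
          M).congr_deriv ?_
        rw [Nat.factorial_succ]
        have h1 : (n.factorial : ℝ) ≠ 0 := by exact_mod_cast Nat.factorial_ne_zero _
        have h2 : (n : ℝ) + 1 ≠ 0 := by positivity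
        push_cast
        simp only [id_eq]
        field_simp
      refine image_norm_le_of_norm_deriv_right_le_deriv_boundary (f := d i) (f' := D i)
        ((hcont i).mono Icc_subset_Ici_self) (fun x hx => hderiv i x hx.1) ?_ hB ?_
      · simp [hzero i]
      · intro x hx
        exact hD x _ hx.1 (by have := hx.1; positivity)
          (fun k => ih k x ⟨hx.1, hx.2.le⟩) i
  intro i t ht
  have hlim : Tendsto (fun n : ℕ => M * ((C * t) ^ n / (n.factorial : ℝ))) atTop (𝓝 (M * 0)) :=
    (FloorSemiring.tendsto_pow_div_factorial_atTop (C * t)).const_mul M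
  rw [mul_zero] at hlim
  have h := ge_of_tendsto' hlim fun n => key n i t ht
  exact abs_nonpos_iff.1 h

/-! ### Transition functions -/

namespace IsTransitionFunction

variable {S : Type*} [DecidableEq S] {Q : S → S → ℝ} {P : ℝ → S → S → ℝ}

theorem sum_le_one (h : IsTransitionFunction Q P) {t : ℝ} (ht : 0 ≤ t) (x : S) (F : Finset S) :
    ∑ z ∈ F, P t x z ≤ 1 :=
  sum_le_hasSum F (fun z _ => h.nonneg t ht x z) (h.hasSum_one t ht x)

theorem le_one (h : IsTransitionFunction Q P) {t : ℝ} (ht : 0 ≤ t) (x y : S) : P t x y ≤ 1 := by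
  simpa using h.sum_le_one ht x {y}

theorem tendsto_cofinite (h : IsTransitionFunction Q P) {t : ℝ} (ht : 0 ≤ t) (x : S) :
    Tendsto (P t x) cofinite (𝓝 0) :=
  (h.hasSum_one t ht x).summable.tendsto_cofinite_zero

/-- The mass that has left a finite set bounds the error of the truncated Chapman-Kolmogorov
equation. -/
theorem abs_sub_sum_le (h : IsTransitionFunction Q P) {s t : ℝ} (hs : 0 ≤ s) (ht : 0 ≤ t)
    (x y : S) (F : Finset S) :
    |P (s + t) x y - ∑ z ∈ F, P s x z * P t z y| ≤ 1 - ∑ z ∈ F, P s x z := by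
  have hck := h.chapman_kolmogorov s t hs ht x y
  have h1 := h.hasSum_one s hs x
  have a : ∑ z ∈ F, P s x z * P t z y ≤ P (s + t) x y :=
    sum_le_hasSum F (fun z _ => mul_nonneg (h.nonneg s hs x z) (h.nonneg t ht z y)) hck
  have hsub := h1.sub hck
  have b : ∑ z ∈ F, (P s x z - P s x z * P t z y) ≤ 1 - P (s + t) x y := by
    refine sum_le_hasSum F (fun z _ => ?_) hsub
    have := mul_le_mul_of_nonneg_left (h.le_one ht z y) (h.nonneg s hs x z)
    linarith
  rw [Finset.sum_sub_distrib] at b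
  rw [abs_of_nonneg (by linarith)]
  linarith

/-- A zero row sum over `F` says that no rate leads from `x` out of `F` to first order, so the
escaped mass is `o(s)`. -/
theorem hasDerivWithinAt_escape (h : IsTransitionFunction Q P) {x : S} {F : Finset S}
    (hQ : ∑ z ∈ F, Q x z = 0) :
    HasDerivWithinAt (fun s => 1 - ∑ z ∈ F, P s x z) 0 (Ici 0) 0 := by
  have := (HasDerivWithinAt.fun_sum (u := F)
    fun z _ => h.hasDerivWithinAt_zero x z).const_sub 1
  rwa [hQ, neg_zero] at this

theorem escape_zero (h : IsTransitionFunction Q P) {x : S} {F : Finset S} (hx : x ∈ F) :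
    1 - ∑ z ∈ F, P 0 x z = 0 := by
  simp [h.zero, hx]

/-- Differentiate the Chapman-Kolmogorov sum truncated to `F` in its first time at `0`; the
truncation error is at most the escaped mass, which is `o(s)`. -/
theorem hasDerivWithinAt_backward (h : IsTransitionFunction Q P) {x : S} {F : Finset S}
    (hx : x ∈ F) (hQ : ∑ z ∈ F, Q x z = 0) (y : S) {t : ℝ} (ht : 0 ≤ t) :
    HasDerivWithinAt (fun u => P u x y) (∑ z ∈ F, Q x z * P t z y) (Ici t) t := by
  have hmain : HasDerivWithinAt (fun s => ∑ z ∈ F, P s x z * P t z y)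
      (∑ z ∈ F, Q x z * P t z y) (Ici 0) 0 :=
    HasDerivWithinAt.fun_sum fun z _ => (h.hasDerivWithinAt_zero x z).mul_const _
  have hrem : HasDerivWithinAt (fun s => P (s + t) x y - ∑ z ∈ F, P s x z * P t z y)
      0 (Ici 0) 0 := by
    have he := h.hasDerivWithinAt_escape hQ
    rw [hasDerivWithinAt_iff_isLittleO] at he ⊢
    refine Asymptotics.IsBigO.trans_isLittleO (Asymptotics.IsBigO.of_bound 1 ?_) he
    filter_upwards [self_mem_nhdsWithin] with s hs
    have h0 : P (0 + t) x y - ∑ z ∈ F, P 0 x z * P t z y = 0 := by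
      have := h.abs_sub_sum_le le_rfl ht x y F
      rw [h.escape_zero hx] at this
      exact abs_nonpos_iff.1 this
    simp only [smul_zero, sub_zero, h0, h.escape_zero hx, one_mul, Real.norm_eq_abs]
    exact (h.abs_sub_sum_le hs ht x y F).trans (le_abs_self _)
  have hsum : HasDerivWithinAt (fun s => P (s + t) x y) (∑ z ∈ F, Q x z * P t z y) (Ici 0) 0 := by
    have := hrem.add hmain
    rw [zero_add] at this
    refine this.congr_of_eventuallyEq (Eventually.of_forall fun s => ?_) ?_ <;> simp
  have hshift : HasDerivWithinAt (fun u : ℝ => u - t) 1 (Ici t) t :=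
    ((hasDerivAt_id t).sub_const t).hasDerivWithinAt
  rw [← sub_self t] at hsum
  have := hsum.comp (h := fun u : ℝ => u - t) t hshift
    (fun u hu => mem_Ici.2 (sub_le_sub_right (mem_Ici.1 hu) t))
  rw [mul_one] at this
  refine this.congr (fun u _ => ?_) ?_ <;> simp

/-- Right derivatives do not control left limits. The increment over a step `s` is therefore bounded
by a modulus `g s` that is independent of the base time: escaped mass plus movement inside `F`. -/
theorem continuousOn (h : IsTransitionFunction Q P) {x : S} {F : Finset S}
    (hx : x ∈ F) (hQ : ∑ z ∈ F, Q x z = 0) (y : S) :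
    ContinuousOn (fun u => P u x y) (Ici 0) := by
  set g : ℝ → ℝ := fun s => (1 - ∑ z ∈ F, P s x z) + ∑ z ∈ F, |P s x z - P 0 x z| with hg
  have hg0 : g 0 = 0 := by simp [hg, h.zero, hx]
  have hgc : ContinuousWithinAt g (Ici 0) 0 := by
    refine (h.hasDerivWithinAt_escape hQ).continuousWithinAt.add ?_
    refine tendsto_finsetSum _ fun z _ => ?_
    exact ((h.hasDerivWithinAt_zero x z).continuousWithinAt.sub continuousWithinAt_const).abs
  have hinc : ∀ s t, 0 ≤ s → 0 ≤ t → |P (s + t) x y - P t x y| ≤ g s := by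
    intro s t hs ht
    have h1 := h.abs_sub_sum_le hs ht x y F
    have h2 : ∑ z ∈ F, P 0 x z * P t z y = P t x y := by simp [h.zero, hx]
    have h3 : |∑ z ∈ F, P s x z * P t z y - P t x y| ≤ ∑ z ∈ F, |P s x z - P 0 x z| := by
      rw [← h2, ← Finset.sum_sub_distrib]
      refine (Finset.abs_sum_le_sum_abs _ _).trans (Finset.sum_le_sum fun z _ => ?_)
      rw [← sub_mul, abs_mul, abs_of_nonneg (h.nonneg t ht z y)]
      exact mul_le_of_le_one_right (abs_nonneg _) (h.le_one ht z y)
    have := (abs_sub_le (P (s + t) x y) (∑ z ∈ F, P s x z * P t z y) (P t x y)).trans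
      (add_le_add h1 h3)
    exact this
  intro v hv
  have hlim : Tendsto (fun u => g |u - v|) (𝓝[Ici 0] v) (𝓝 0) := by
    have hw : Tendsto (fun u : ℝ => |u - v|) (𝓝[Ici 0] v) (𝓝[Ici 0] 0) := by
      refine tendsto_nhdsWithin_of_tendsto_nhds_of_eventually_within _ ?_
        (Eventually.of_forall fun u => mem_Ici.2 (abs_nonneg _))
      have : Continuous fun u : ℝ => |u - v| := by fun_prop
      simpa using (this.tendsto v).mono_left nhdsWithin_le_nhds
    have := hgc.tendsto.comp hw
    rwa [hg0] at this
  rw [ContinuousWithinAt, tendsto_iff_dist_tendsto_zero]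
  refine squeeze_zero' (Eventually.of_forall fun _ => dist_nonneg) ?_ hlim
  filter_upwards [self_mem_nhdsWithin] with u hu
  rw [Real.dist_eq]
  rcases le_total v u with huv | huv
  · have := hinc (u - v) v (by linarith) hv
    rwa [sub_add_cancel, ← abs_of_nonneg (sub_nonneg.2 huv)] at this
  · have := hinc (v - u) u (by linarith) hu
    rwa [sub_add_cancel, abs_sub_comm, ← abs_of_nonneg (sub_nonneg.2 huv), abs_sub_comm v u] at this

end IsTransitionFunction

/-! ### Birth-death equations with killing -/

/-- The absolute coefficients add up to `2 * (l + m) + κ`, uniformly in the state; the boundary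
value `d 0 = 0` closes the system. -/
theorem eq_zero_of_birthDeath {l m κ M T : ℝ} (hl : 0 ≤ l) (hm : 0 ≤ m) (hκ : 0 ≤ κ) (hM : 0 ≤ M)
    {d : ℕ → ℝ → ℝ} (hcont : ∀ k, ContinuousOn (d (k + 1)) (Ici 0))
    (hderiv : ∀ k t, 0 ≤ t → HasDerivWithinAt (d (k + 1))
      (l * d (k + 2) t + m * d k t - (l + m + κ) * d (k + 1) t) (Ici t) t)
    (hzero_left : ∀ t, 0 ≤ t → d 0 t = 0) (hzero : ∀ k, d (k + 1) 0 = 0)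
    (hbound : ∀ k, ∀ t ∈ Icc 0 T, |d (k + 1) t| ≤ M) (k : ℕ) {t : ℝ} (ht : t ∈ Icc 0 T) :
    d (k + 1) t = 0 := by
  refine eq_zero_of_deriv_right_bound (d := fun k => d (k + 1))
    (D := fun k t => l * d (k + 2) t + m * d k t - (l + m + κ) * d (k + 1) t)
    (C := 2 * (l + m) + κ) hM (by positivity) hcont hderiv hzero hbound ?_ k t ht
  intro t B ht hB hd i
  have h1 := hd (i + 1)
  have h2 : |d i t| ≤ B := by
    rcases i with _ | i
    · simpa [hzero_left t ht] using hB
    · exact hd i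
  have h3 := hd i
  have e1 : |l * d (i + 2) t| ≤ l * B := by
    rw [abs_mul, abs_of_nonneg hl]; exact mul_le_mul_of_nonneg_left h1 hl
  have e2 : |m * d i t| ≤ m * B := by
    rw [abs_mul, abs_of_nonneg hm]; exact mul_le_mul_of_nonneg_left h2 hm
  have e3 : |(l + m + κ) * d (i + 1) t| ≤ (l + m + κ) * B := by
    rw [abs_mul, abs_of_nonneg (by positivity : 0 ≤ l + m + κ)]
    exact mul_le_mul_of_nonneg_left h3 (by positivity)
  have e4 := abs_sub (l * d (i + 2) t + m * d i t) ((l + m + κ) * d (i + 1) t)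
  have e5 := abs_add_le (l * d (i + 2) t) (m * d i t)
  linarith

/-- The bounded solution of the backward equations of the queue absorbed at `0` and killed at
rate `κ`, started from the indicator of `n`. -/
theorem eq_exp_mul_zeroAvoidingProb {l m κ : ℝ} (hl : 0 < l) (hm : 0 < m) (hκ : 0 ≤ κ) {n : ℕ}
    {f : ℕ → ℝ → ℝ} (hcont : ∀ k, ContinuousOn (f (k + 1)) (Ici 0))
    (hderiv : ∀ k t, 0 ≤ t → HasDerivWithinAt (f (k + 1))
      (l * f (k + 2) t + m * f k t - (l + m + κ) * f (k + 1) t) (Ici t) t)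
    (hzero_left : ∀ t, 0 ≤ t → f 0 t = 0)
    (hinit : ∀ k, f (k + 1) 0 = if k + 1 = n then 1 else 0)
    (hbound : ∀ k t, 0 ≤ t → |f k t| ≤ 1) (k : ℕ) {t : ℝ} (ht : 0 ≤ t) :
    f k t = Real.exp (-κ * t) * zeroAvoidingProb l m k n t := by
  rcases k with _ | k
  · rw [hzero_left t ht, zeroAvoidingProb_zero_left, mul_zero]
  have hexp : ∀ s : ℝ, HasDerivAt (fun t : ℝ => Real.exp (-κ * t))
      (Real.exp (-κ * s) * (-κ * 1)) s := fun s => ((hasDerivAt_id s).const_mul _).exp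
  have hv : ∀ k s, HasDerivAt (fun t => Real.exp (-κ * t) * zeroAvoidingProb l m (k + 1) n t)
      _ s := fun k s => (hexp s).mul (hasDerivAt_zeroAvoidingProb_backward hl hm k n s)
  rw [← sub_eq_zero]
  refine eq_zero_of_birthDeath
    (d := fun k t => f k t - Real.exp (-κ * t) * zeroAvoidingProb l m k n t) (T := t)
    (M := 1 + (1 + √(l / m) ^ (2 * (n : ℤ)))) hl.le hm.le hκ (by positivity) ?_ ?_ ?_ ?_ ?_ k
    ⟨ht, le_rfl⟩
  · exact fun k => (hcont k).sub fun s _ => (hv k s).continuousAt.continuousWithinAt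
  · intro k s hs
    refine ((hderiv k s hs).sub (hv k s).hasDerivWithinAt).congr_deriv ?_
    ring
  · intro s hs
    simp only [hzero_left s hs, zeroAvoidingProb_zero_left, mul_zero, sub_zero]
  · intro k
    simp only [hinit k, mul_zero, Real.exp_zero, one_mul]
    rw [zeroAvoidingProb_time_zero hl hm (by omega), sub_self]
  · intro k s hs
    refine (abs_sub _ _).trans (add_le_add (hbound _ s hs.1) ?_)
    rw [abs_mul, Real.abs_exp]
    have h1 : Real.exp (-κ * s) ≤ 1 :=
      Real.exp_le_one_iff.2 (by have := mul_nonneg hκ hs.1; linarith)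
    exact (mul_le_of_le_one_left (abs_nonneg _) h1).trans
      (abs_zeroAvoidingProb_le hl hm (k + 1) n hs.1)

/-- Duhamel's formula: if `A` solves the forward equations of a killed birth-death process started
in `i + 1`, and `w` solves the backward equations with source `η * c`, then `w (i + 1) t` is the
integral of `A` against the source. -/
theorem hasSum_duhamel {l m η t : ℝ} (hη : 0 ≤ η) (ht : 0 ≤ t) {i : ℕ} {A w c : ℕ → ℝ → ℝ}
    (hA : ∀ k s, HasDerivAt (A (k + 1))
      (l * A k s + m * A (k + 2) s - (l + m + η) * A (k + 1) s) s)
    (hA_zero : ∀ s, A 0 s = 0) (hA_init : ∀ k, A (k + 1) 0 = if i + 1 = k + 1 then 1 else 0)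
    (hA_nonneg : ∀ k, ∀ s, 0 ≤ s → 0 ≤ A k s) (hA_le : ∀ k, ∀ s, 0 ≤ s → A k s ≤ 1)
    (hA_lim : ∀ s, 0 ≤ s → Tendsto (fun k => A k s) atTop (𝓝 0))
    (hw : ∀ k s, 0 ≤ s → HasDerivWithinAt (w (k + 1))
      (l * w (k + 2) s + m * w k s + η * c (k + 1) s - (l + m + η) * w (k + 1) s) (Ici s) s)
    (hw_cont : ∀ k, ContinuousOn (w k) (Ici 0)) (hw_zero : ∀ s, 0 ≤ s → w 0 s = 0)
    (hw_init : ∀ k, w (k + 1) 0 = 0) (hw_le : ∀ k s, 0 ≤ s → |w k s| ≤ 1)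
    (hc_cont : ∀ k, ContinuousOn (c k) (Ici 0)) (hc_nonneg : ∀ k s, 0 ≤ s → 0 ≤ c k s) :
    HasSum (fun k => η * ∫ τ in (0 : ℝ)..t, A (k + 1) τ * c (k + 1) (t - τ)) (w (i + 1) t) := by
  have hA_cont : ∀ k, Continuous (A k) := by
    rintro (_ | k)
    · rw [show A 0 = fun _ => 0 from funext hA_zero]; exact continuous_const
    · exact continuous_iff_continuousAt.2 fun s => (hA k s).continuousAt
  have hA' : ∀ k, ContinuousOn (fun s => A k (t - s)) (Icc 0 t) := fun k =>
    ((hA_cont k).comp (continuous_const.sub continuous_id)).continuousOn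
  have hw' : ∀ k, ContinuousOn (w k) (Icc 0 t) := fun k => (hw_cont k).mono Icc_subset_Ici_self
  have hc' : ∀ k, ContinuousOn (c k) (Icc 0 t) := fun k => (hc_cont k).mono Icc_subset_Ici_self
  have hint : ∀ {f : ℝ → ℝ}, ContinuousOn f (Icc 0 t) → IntervalIntegrable f volume 0 t :=
    fun hf => ContinuousOn.intervalIntegrable (by rwa [uIcc_of_le ht])
  -- The flux across level `N`: what is left at the upper end after the birth and death terms
  -- telescope.
  set b : ℕ → ℝ → ℝ := fun N s =>
    l * (A N (t - s) * w (N + 1) s) - m * (A (N + 1) (t - s) * w N s) with hb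
  have hb_cont : ∀ N, ContinuousOn (b N) (Icc 0 t) := fun N =>
    (((hA' N).mul (hw' (N + 1))).const_mul l).sub (((hA' (N + 1)).mul (hw' N)).const_mul m)
  have hAc : ∀ k, ContinuousOn (fun s => η * (A (k + 1) (t - s) * c (k + 1) s)) (Icc 0 t) :=
    fun k => ((hA' (k + 1)).mul (hc' (k + 1))).const_mul η
  have hS : ∀ N : ℕ, ContinuousOn
      (fun s => ∑ k ∈ Finset.range N, η * (A (k + 1) (t - s) * c (k + 1) s)) (Icc 0 t) :=
    fun N => continuousOn_finsetSum _ fun k _ => hAc k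
  have hA_sub : ∀ k s, HasDerivAt (fun s => A (k + 1) (t - s))
      (-(l * A k (t - s) + m * A (k + 2) (t - s) - (l + m + η) * A (k + 1) (t - s))) s := by
    intro k s
    have h := (hA k (t - s)).comp s ((hasDerivAt_id s).const_sub t)
    rwa [mul_neg, mul_one] at h
  have hftc : ∀ N : ℕ, ∫ s in (0 : ℝ)..t,
      ((∑ k ∈ Finset.range N, η * (A (k + 1) (t - s) * c (k + 1) s)) + b N s) =
      (∑ k ∈ Finset.range N, A (k + 1) (t - t) * w (k + 1) t) -
        ∑ k ∈ Finset.range N, A (k + 1) (t - 0) * w (k + 1) 0 := by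
    intro N
    refine intervalIntegral.integral_eq_sub_of_hasDeriv_right_of_le ht
      (f := fun s => ∑ k ∈ Finset.range N, A (k + 1) (t - s) * w (k + 1) s) ?_ ?_ ?_
    · exact continuousOn_finsetSum _ fun k _ => (hA' (k + 1)).mul (hw' (k + 1))
    · intro s hs
      refine (HasDerivWithinAt.fun_sum fun k _ => (hA_sub k s).hasDerivWithinAt.mul
        ((hw k s hs.1.le).mono Ioi_subset_Ici_self)).congr_deriv ?_
      -- The lower ends of both telescoping sums vanish, because `A 0` and `w 0` do.
      have t1 := Finset.sum_range_sub (fun k => A k (t - s) * w (k + 1) s) N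
      have t2 := Finset.sum_range_sub (fun k => A (k + 1) (t - s) * w k s) N
      simp only [hA_zero, hw_zero s hs.1.le, zero_mul, mul_zero, sub_zero] at t1 t2
      rw [hb]
      simp only
      rw [← t1, ← t2, Finset.mul_sum, Finset.mul_sum, ← Finset.sum_sub_distrib,
        ← Finset.sum_add_distrib]
      refine Finset.sum_congr rfl fun k _ => ?_
      ring
    · exact hint ((hS N).add (hb_cont N))
  -- The flux is bounded by `|l| + |m|` and tends to `0` pointwise, since `A N` does while `w` stays
  -- bounded.
  have hb_lim : Tendsto (fun N => ∫ s in (0 : ℝ)..t, b N s) atTop (𝓝 0) := by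
    suffices h : Tendsto (fun N => ∫ s in (0 : ℝ)..t, b N s) atTop
        (𝓝 (∫ _ in (0 : ℝ)..t, (0 : ℝ))) by
      rwa [intervalIntegral.integral_zero] at h
    refine intervalIntegral.tendsto_integral_filter_of_dominated_convergence
      (fun _ => |l| + |m|) (Eventually.of_forall fun N => ?_) (Eventually.of_forall fun N => ?_)
      intervalIntegrable_const ?_
    · exact (hint (hb_cont N)).aestronglyMeasurable_restrict_uIoc
    · refine ae_of_all _ fun s hs => ?_
      rw [uIoc_of_le ht] at hs
      have hts : 0 ≤ t - s := sub_nonneg.2 hs.2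
      have hprod : ∀ p q, |A p (t - s) * w q s| ≤ 1 := fun p q => by
        rw [abs_mul, abs_of_nonneg (hA_nonneg p _ hts)]
        exact mul_le_one₀ (hA_le p _ hts) (abs_nonneg _) (hw_le q s hs.1.le)
      refine (abs_sub _ _).trans ?_
      rw [abs_mul l, abs_mul m]
      exact add_le_add (mul_le_of_le_one_right (abs_nonneg _) (hprod _ _))
        (mul_le_of_le_one_right (abs_nonneg _) (hprod _ _))
    · refine ae_of_all _ fun s hs => ?_
      rw [uIoc_of_le ht] at hs
      have hts : 0 ≤ t - s := sub_nonneg.2 hs.2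
      have hprod : ∀ p q : ℕ → ℕ, Tendsto p atTop atTop →
          Tendsto (fun N => A (p N) (t - s) * w (q N) s) atTop (𝓝 0) := by
        intro p q hp
        refine squeeze_zero_norm (fun N => ?_) ((hA_lim _ hts).comp hp)
        rw [norm_mul, Real.norm_eq_abs, Real.norm_eq_abs, abs_of_nonneg (hA_nonneg _ _ hts)]
        exact mul_le_of_le_one_right (hA_nonneg _ _ hts) (hw_le _ _ hs.1.le)
      have := ((hprod id (· + 1) tendsto_id).const_mul l).sub
        ((hprod (· + 1) id (tendsto_add_atTop_nat 1)).const_mul m)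
      simpa using this
  have hterm : ∀ k, ∫ s in (0 : ℝ)..t, η * (A (k + 1) (t - s) * c (k + 1) s) =
      η * ∫ τ in (0 : ℝ)..t, A (k + 1) τ * c (k + 1) (t - τ) := by
    intro k
    rw [intervalIntegral.integral_const_mul]
    have := intervalIntegral.integral_comp_sub_left
      (fun τ => A (k + 1) τ * c (k + 1) (t - τ)) t (a := 0) (b := t)
    simp only [sub_sub_cancel, sub_self, sub_zero] at this
    rw [this]
  -- `i < N` keeps the initial state of `A` inside the truncated sum, where its indicator selects `w
  -- (i + 1) t`.
  have hpartial : ∀ N : ℕ, i < N →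
      ∑ k ∈ Finset.range N, η * ∫ τ in (0 : ℝ)..t, A (k + 1) τ * c (k + 1) (t - τ) =
        w (i + 1) t - ∫ s in (0 : ℝ)..t, b N s := by
    intro N hN
    have h := hftc N
    rw [intervalIntegral.integral_add (hint (hS N)) (hint (hb_cont N)),
      intervalIntegral.integral_finsetSum fun k _ => hint (hAc k)] at h
    simp only [hterm, hw_init, hA_init, sub_self, mul_zero, Finset.sum_const_zero, sub_zero] at h
    have h1 : ∑ k ∈ Finset.range N, (if i + 1 = k + 1 then (1 : ℝ) else 0) * w (k + 1) t =
        w (i + 1) t := by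
      rw [Finset.sum_eq_single i]
      · simp
      · intro k _ hk
        rw [if_neg (by omega), zero_mul]
      · intro h; exact absurd (Finset.mem_range.2 hN) h
    rw [h1] at h
    linarith
  rw [hasSum_iff_tendsto_nat_of_nonneg]
  · have : Tendsto (fun N => w (i + 1) t - ∫ s in (0 : ℝ)..t, b N s) atTop
        (𝓝 (w (i + 1) t - 0)) := tendsto_const_nhds.sub hb_lim
    rw [sub_zero] at this
    refine this.congr' ?_
    filter_upwards [eventually_gt_atTop i] with N hN
    exact (hpartial N hN).symm
  · intro k
    refine mul_nonneg hη (intervalIntegral.integral_nonneg ht fun s hs => ?_)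
    exact mul_nonneg (hA_nonneg _ _ hs.1) (hc_nonneg _ _ (sub_nonneg.2 hs.2))

/-! ### The generator of the queue absorbed at `0` -/

section Generator

variable {lam mu eta : Env → ℝ}

theorem rateGenerator_absorbedRate_zero (e : Env) (y : ℕ × Env) :
    rateGenerator (absorbedRate lam mu eta) (0, e) y = 0 := by
  simp [rateGenerator, absorbedRate]

/-- The states that can be reached from `(k + 1, e)` in at most one transition; `e'` is the other
environment. -/
def neighbours (k : ℕ) (e e' : Env) : Finset (ℕ × Env) :=
  {(k + 1, e), (k + 2, e), (k, e), (k + 1, e')}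

theorem sum_neighbours {e e' : Env} (he : e ≠ e') (k : ℕ) (g : ℕ × Env → ℝ) :
    ∑ z ∈ neighbours k e e', g z =
      g (k + 1, e) + (g (k + 2, e) + (g (k, e) + g (k + 1, e'))) := by
  rw [neighbours, Finset.sum_insert (by simp [he]), Finset.sum_insert (by simp [he]),
    Finset.sum_insert (by simp [he]), Finset.sum_singleton]

theorem rateGenerator_absorbedRate_self {e e' : Env} (he : e ≠ e') (k : ℕ) :
    rateGenerator (absorbedRate lam mu eta) (k + 1, e) (k + 1, e) =
      -(lam e + mu e + eta e) := by
  rw [rateGenerator, if_pos rfl, tsum_eq_sum (s := neighbours k e e'), sum_neighbours he]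
  · have hk : k ≠ k + 1 + 1 := by omega
    simp [absorbedRate, queueRate, he.symm, hk]
    ring
  · rintro ⟨z, f⟩ hz
    have hf : f = e ∨ f = e' := by cases e <;> cases e' <;> cases f <;> simp_all
    simp only [neighbours, Finset.mem_insert, Finset.mem_singleton, Prod.mk.injEq, not_or] at hz
    rcases hf with rfl | rfl
    · have h1 : z ≠ k + 1 := fun h => hz.1 ⟨h, rfl⟩
      have h2 : z ≠ k + 2 := fun h => hz.2.1 ⟨h, rfl⟩
      have h3 : ¬ k = z := fun h => hz.2.2.1 ⟨h.symm, rfl⟩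
      simp [absorbedRate, queueRate, h2, h3]
    · have h1 : z ≠ k + 1 := fun h => hz.2.2.2 ⟨h, rfl⟩
      simp [absorbedRate, queueRate, h1, he.symm]

theorem sum_rateGenerator_absorbedRate {e e' : Env} (he : e ≠ e') (k : ℕ) (g : ℕ × Env → ℝ) :
    ∑ z ∈ neighbours k e e', rateGenerator (absorbedRate lam mu eta) (k + 1, e) z * g z =
      lam e * g (k + 2, e) + mu e * g (k, e) + eta e * g (k + 1, e') -
        (lam e + mu e + eta e) * g (k + 1, e) := by
  have h1 : rateGenerator (absorbedRate lam mu eta) (k + 1, e) (k + 2, e) = lam e := by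
    simp [rateGenerator, absorbedRate, queueRate]
  have h2 : rateGenerator (absorbedRate lam mu eta) (k + 1, e) (k, e) = mu e := by
    simp [rateGenerator, absorbedRate, queueRate]
    omega
  have h3 : rateGenerator (absorbedRate lam mu eta) (k + 1, e) (k + 1, e') = eta e := by
    simp [rateGenerator, absorbedRate, queueRate, he, he.symm]
  rw [sum_neighbours he, rateGenerator_absorbedRate_self he, h1, h2, h3]
  ring

theorem sum_rateGenerator_absorbedRate_eq_zero {e e' : Env} (he : e ≠ e') (k : ℕ) :
    ∑ z ∈ neighbours k e e', rateGenerator (absorbedRate lam mu eta) (k + 1, e) z = 0 := by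
  have := sum_rateGenerator_absorbedRate (lam := lam) (mu := mu) (eta := eta) he k fun _ => 1
  simp only [mul_one] at this
  rw [this]
  ring

end Generator

/-! ### Transition probabilities of the absorbed queue -/

namespace IsTransitionFunction

variable {lam mu eta : Env → ℝ} {P : ℝ → ℕ × Env → ℕ × Env → ℝ}

theorem queue_abs_le_one (h : IsTransitionFunction (rateGenerator (absorbedRate lam mu eta)) P)
    {t : ℝ} (ht : 0 ≤ t) (x y : ℕ × Env) : |P t x y| ≤ 1 := by
  rw [abs_of_nonneg (h.nonneg t ht x y)]
  exact h.le_one ht x y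

theorem queue_continuousOn (h : IsTransitionFunction (rateGenerator (absorbedRate lam mu eta)) P)
    (x y : ℕ × Env) : ContinuousOn (fun t => P t x y) (Ici 0) := by
  obtain ⟨_ | k, e⟩ := x
  · exact h.continuousOn (F := {(0, e)}) (Finset.mem_singleton_self _)
      (by simp [rateGenerator_absorbedRate_zero]) y
  · obtain ⟨e', he⟩ : ∃ e', e ≠ e' := by
      cases e
      exacts [⟨Env.two, by simp⟩, ⟨Env.one, by simp⟩]
    exact h.continuousOn (F := neighbours k e e') (by simp [neighbours])
      (sum_rateGenerator_absorbedRate_eq_zero he k) y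

theorem queue_absorbed (h : IsTransitionFunction (rateGenerator (absorbedRate lam mu eta)) P)
    (e : Env) (y : ℕ × Env) {t : ℝ} (ht : 0 ≤ t) : P t (0, e) y = P 0 (0, e) y := by
  refine constant_of_has_deriv_right_zero (f := fun t => P t (0, e) y)
    ((h.queue_continuousOn _ y).mono Icc_subset_Ici_self) (fun s hs => ?_) t ⟨ht, le_rfl⟩
  have := h.hasDerivWithinAt_backward (F := {(0, e)}) (Finset.mem_singleton_self _)
    (by simp [rateGenerator_absorbedRate_zero]) y hs.1
  simpa [rateGenerator_absorbedRate_zero] using this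

theorem queue_absorbed_eq_zero
    (h : IsTransitionFunction (rateGenerator (absorbedRate lam mu eta)) P)
    (e e' : Env) {n : ℕ} (hn : 1 ≤ n) {t : ℝ} (ht : 0 ≤ t) : P t (0, e) (n, e') = 0 := by
  rw [h.queue_absorbed e _ ht, h.zero, if_neg]
  simp only [Prod.mk.injEq, not_and]
  omega

theorem queue_hasDerivWithinAt
    (h : IsTransitionFunction (rateGenerator (absorbedRate lam mu eta)) P)
    {e e' : Env} (he : e ≠ e') (k : ℕ) (y : ℕ × Env) {t : ℝ} (ht : 0 ≤ t) :
    HasDerivWithinAt (fun s => P s (k + 1, e) y)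
      (lam e * P t (k + 2, e) y + mu e * P t (k, e) y + eta e * P t (k + 1, e') y -
        (lam e + mu e + eta e) * P t (k + 1, e) y) (Ici t) t := by
  have := h.hasDerivWithinAt_backward (F := neighbours k e e') (by simp [neighbours])
    (sum_rateGenerator_absorbedRate_eq_zero he k) y ht
  rwa [sum_rateGenerator_absorbedRate he k fun z => P t z y] at this

/-- With no switching out of two, these entries solve a closed homogeneous system with zero initial
data. -/
theorem queue_two_one_eq_zero
    (h : IsTransitionFunction (rateGenerator (absorbedRate lam mu eta)) P)
    (hlam : ∀ i, 0 < lam i) (hmu : ∀ i, 0 < mu i) (heta_two : eta Env.two = 0)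
    {n : ℕ} (hn : 1 ≤ n) (k : ℕ) {t : ℝ} (ht : 0 ≤ t) :
    P t (k, Env.two) (n, Env.one) = 0 := by
  rcases k with _ | k
  · exact h.queue_absorbed_eq_zero _ _ hn ht
  refine eq_zero_of_birthDeath (d := fun k t => P t (k, Env.two) (n, Env.one)) (T := t) (M := 1)
    (hlam Env.two).le (hmu Env.two).le (κ := 0) le_rfl zero_le_one
    (fun k => h.queue_continuousOn _ _) (fun k s hs => ?_)
    (fun s hs => h.queue_absorbed_eq_zero _ _ hn hs) (fun k => by simp [h.zero])
    (fun k s hs => h.queue_abs_le_one hs.1 _ _) k ⟨ht, le_rfl⟩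
  refine (h.queue_hasDerivWithinAt (by simp : Env.two ≠ Env.one) k _ hs).congr_deriv ?_
  rw [heta_two]
  ring

theorem queue_two_two (h : IsTransitionFunction (rateGenerator (absorbedRate lam mu eta)) P)
    (hlam : ∀ i, 0 < lam i) (hmu : ∀ i, 0 < mu i) (heta_two : eta Env.two = 0)
    {n : ℕ} (hn : 1 ≤ n) (k : ℕ) {t : ℝ} (ht : 0 ≤ t) :
    P t (k, Env.two) (n, Env.two) = zeroAvoidingProb (lam Env.two) (mu Env.two) k n t := by
  refine (eq_exp_mul_zeroAvoidingProb (f := fun k t => P t (k, Env.two) (n, Env.two)) (n := n)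
    (hlam Env.two) (hmu Env.two) (κ := 0) le_rfl
    (fun k => h.queue_continuousOn _ _) (fun k s hs => ?_)
    (fun s hs => h.queue_absorbed_eq_zero _ _ hn hs) (fun k => by simp [h.zero])
    (fun k s hs => h.queue_abs_le_one hs _ _) k ht).trans (by simp)
  refine (h.queue_hasDerivWithinAt (by simp : Env.two ≠ Env.one) k _ hs).congr_deriv ?_
  rw [heta_two]
  ring

/-- There is no return from two, so the switching term drops out and only the loss rate `eta
Env.one` remains. -/
theorem queue_one_one (h : IsTransitionFunction (rateGenerator (absorbedRate lam mu eta)) P)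
    (hlam : ∀ i, 0 < lam i) (hmu : ∀ i, 0 < mu i) (heta : ∀ i, 0 ≤ eta i)
    (heta_two : eta Env.two = 0) {n : ℕ} (hn : 1 ≤ n) (k : ℕ) {t : ℝ} (ht : 0 ≤ t) :
    P t (k, Env.one) (n, Env.one) =
      Real.exp (-eta Env.one * t) * zeroAvoidingProb (lam Env.one) (mu Env.one) k n t := by
  refine eq_exp_mul_zeroAvoidingProb (f := fun k t => P t (k, Env.one) (n, Env.one))
    (hlam Env.one) (hmu Env.one) (heta Env.one)
    (fun k => h.queue_continuousOn _ _) (fun k s hs => ?_)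
    (fun s hs => h.queue_absorbed_eq_zero _ _ hn hs) (fun k => by simp [h.zero])
    (fun k s hs => h.queue_abs_le_one hs _ _) k ht
  refine (h.queue_hasDerivWithinAt (by simp : Env.one ≠ Env.two) k _ hs).congr_deriv ?_
  rw [h.queue_two_one_eq_zero hlam hmu heta_two hn _ hs]
  ring

theorem queue_one_two (h : IsTransitionFunction (rateGenerator (absorbedRate lam mu eta)) P)
    (hlam : ∀ i, 0 < lam i) (hmu : ∀ i, 0 < mu i) (heta : ∀ i, 0 ≤ eta i)
    (heta_two : eta Env.two = 0) {n : ℕ} (hn : 1 ≤ n) {j : ℕ} (hj : 1 ≤ j) {t : ℝ} (ht : 0 ≤ t) :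
    HasSum (fun k : ℕ => eta Env.one * ∫ τ in (0 : ℝ)..t, Real.exp (-eta Env.one * τ) *
        zeroAvoidingProb (lam Env.one) (mu Env.one) j (k + 1) τ *
        zeroAvoidingProb (lam Env.two) (mu Env.two) (k + 1) n (t - τ))
      (P t (j, Env.one) (n, Env.two)) := by
  obtain ⟨i, rfl⟩ : ∃ i, j = i + 1 := ⟨j - 1, by omega⟩
  set A : ℕ → ℝ → ℝ := fun k τ => Real.exp (-eta Env.one * τ) *
    zeroAvoidingProb (lam Env.one) (mu Env.one) (i + 1) k τ with hAdef
  have hA_zero : ∀ s, A 0 s = 0 := fun s => by simp [hAdef, zeroAvoidingProb_zero_right]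
  -- Identifying `A` with entries of `P` supplies the sign, the bound by `1` and, by summability of
  -- a row, the decay at infinity, none of which is evident from the Bessel formula.
  have hA_eq : ∀ k s, 0 ≤ s → A (k + 1) s = P s (i + 1, Env.one) (k + 1, Env.one) := fun k s hs =>
    (h.queue_one_one hlam hmu heta heta_two (by omega) _ hs).symm
  have hexp : ∀ s : ℝ, HasDerivAt (fun t : ℝ => Real.exp (-eta Env.one * t))
      (Real.exp (-eta Env.one * s) * (-eta Env.one * 1)) s :=
    fun s => ((hasDerivAt_id s).const_mul _).exp
  have hsum := hasSum_duhamel (l := lam Env.one) (m := mu Env.one) (η := eta Env.one) (i := i)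
    (A := A) (w := fun k t => P t (k, Env.one) (n, Env.two))
    (c := fun k t => P t (k, Env.two) (n, Env.two)) (heta Env.one) ht ?_ hA_zero ?_ ?_ ?_ ?_
    (fun k s hs => h.queue_hasDerivWithinAt (by simp) k _ hs) (fun k => h.queue_continuousOn _ _)
    (fun s hs => h.queue_absorbed_eq_zero _ _ hn hs) (fun k => by simp [h.zero])
    (fun k s hs => h.queue_abs_le_one hs _ _) (fun k => h.queue_continuousOn _ _)
    (fun k s hs => h.nonneg s hs _ _)
  · refine hsum.congr_fun fun k => ?_
    congr 1
    refine intervalIntegral.integral_congr fun τ hτ => ?_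
    rw [uIcc_of_le ht] at hτ
    simp only [hAdef, h.queue_two_two hlam hmu heta_two hn _ (sub_nonneg.2 hτ.2)]
  · intro k s
    refine ((hexp s).mul (hasDerivAt_zeroAvoidingProb_forward (hlam Env.one) (hmu Env.one)
      (i + 1) k s)).congr_deriv ?_
    ring
  · intro k
    simp [hAdef, zeroAvoidingProb_time_zero (hlam Env.one) (hmu Env.one)]
  · rintro (_ | k) s hs
    · rw [hA_zero]
    · rw [hA_eq k s hs]; exact h.nonneg s hs _ _
  · rintro (_ | k) s hs
    · rw [hA_zero]; exact zero_le_one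
    · rw [hA_eq k s hs]; exact h.le_one hs _ _
  · intro s hs
    rw [← tendsto_add_atTop_iff_nat 1]
    simp only [hA_eq _ s hs]
    have hinj : Function.Injective fun k : ℕ => (k + 1, Env.one) := fun a b hab => by
      simpa using hab
    have := (h.tendsto_cofinite hs (i + 1, Env.one)).comp hinj.tendsto_cofinite
    rwa [Nat.cofinite_eq_atTop] at this

end IsTransitionFunction

/-! ### The one-dimensional distributions -/

/-- The initial law gives mass one to the two starting states, so the event splits over them up to a
null set, and the two-time distributions evaluate each piece. -/
theorem measureReal_eq_of_markov {j : ℕ} {p : ℝ}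
    {Ω : Type*} [MeasurableSpace Ω] (ℙ : Measure Ω) [IsProbabilityMeasure ℙ]
    {X : ℝ≥0 → Ω → ℕ × Env} {P : ℝ → ℕ × Env → ℕ × Env → ℝ}
    (hmeas : ∀ t x, MeasurableSet {ω | X t ω = x})
    (hfdd : ∀ (m : ℕ) (t : Fin (m + 1) → ℝ≥0) (x : Fin (m + 1) → ℕ × Env), Monotone t → t 0 = 0 →
      ℙ.real {ω | ∀ k, X (t k) ω = x k} =
        initialLaw j p (x 0) * ∏ k : Fin m,
          P ((t k.succ : ℝ) - (t k.castSucc : ℝ)) (x k.castSucc) (x k.succ))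
    (t : ℝ≥0) (y : ℕ × Env) :
    ℙ.real {ω | X t ω = y} = p * P t (j, Env.one) y + (1 - p) * P t (j, Env.two) y := by
  have h0 : ∀ x, ℙ.real {ω | X 0 ω = x} = initialLaw j p x := by
    intro x
    have := hfdd 0 (fun _ => 0) (fun _ => x) monotone_const rfl
    simpa using this
  have h1 : ∀ x, ℙ.real {ω | X 0 ω = x ∧ X t ω = y} = initialLaw j p x * P t x y := by
    intro x
    have := hfdd 1 ![0, t] ![x, y] ?_ rfl
    · simpa [Fin.forall_fin_two] using this
    · intro a b hab
      fin_cases a <;> fin_cases b <;> simp_all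
  set A := {ω | X 0 ω = (j, Env.one)}
  set B := {ω | X 0 ω = (j, Env.two)}
  set E := {ω | X t ω = y}
  have hdisj : Disjoint A B := by
    rw [Set.disjoint_left]
    intro ω h1 h2
    have h1 : X 0 ω = (j, Env.one) := h1
    have h2 : X 0 ω = (j, Env.two) := h2
    rw [h1] at h2
    simp at h2
  have hAm : MeasurableSet A := hmeas _ _
  have hBm : MeasurableSet B := hmeas _ _
  have hEm : MeasurableSet E := hmeas _ _
  have hfull : ℙ.real (A ∪ B) = 1 := by
    rw [measureReal_union hdisj hBm, h0, h0]
    simp [initialLaw]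
  have hcompl : ℙ.real (E \ (A ∪ B)) = 0 := by
    have : ℙ.real (A ∪ B)ᶜ = 0 := by
      rw [probReal_compl_eq_one_sub (hAm.union hBm), hfull, sub_self]
    refine le_antisymm ?_ measureReal_nonneg
    rw [← this]
    exact measureReal_mono fun ω hω => hω.2
  have hsplit := measureReal_inter_add_sdiff (μ := ℙ) (s := E) (hAm.union hBm)
  rw [hcompl, add_zero, Set.inter_union_distrib_left, measureReal_union
    (hdisj.mono inter_subset_right inter_subset_right) (hEm.inter hBm)] at hsplit
  have eA : E ∩ A = {ω | X 0 ω = (j, Env.one) ∧ X t ω = y} := by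
    ext ω; exact and_comm
  have eB : E ∩ B = {ω | X 0 ω = (j, Env.two) ∧ X t ω = y} := by
    ext ω; exact and_comm
  rw [← hsplit, eA, eB, h1, h1]
  simp [initialLaw]

theorem proposition3 (lam mu eta : Env → ℝ)
    (hlam : ∀ i, 0 < lam i) (hmu : ∀ i, 0 < mu i) (heta : ∀ i, 0 ≤ eta i)
    (heta_pos : 0 < eta Env.one + eta Env.two) (heta_two : eta Env.two = 0)
    (j : ℕ) (hj : 1 ≤ j) (p : ℝ) (hp0 : 0 ≤ p) (hp1 : p ≤ 1)
    {Ω : Type*} [MeasurableSpace Ω] (ℙ : Measure Ω) [IsProbabilityMeasure ℙ]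
    (X : ℝ≥0 → Ω → ℕ × Env)
    (hX : IsMarkovChain (rateGenerator (absorbedRate lam mu eta)) (initialLaw j p) ℙ X)
    (n : ℕ) (hn : 1 ≤ n) (t : ℝ≥0) (ht : 0 < t) :
    -- the state probabilities in the first environment
    ℙ.real {ω | X t ω = (n, Env.one)} =
        p * Real.exp (-eta Env.one * t) * zeroAvoidingProb (lam Env.one) (mu Env.one) j n t ∧
    -- the integrals and the series of the second formula are meaningful
    (∀ k : ℕ, 1 ≤ k → IntervalIntegrable
        (fun τ : ℝ => Real.exp (-eta Env.one * τ) *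
          zeroAvoidingProb (lam Env.one) (mu Env.one) j k τ *
          zeroAvoidingProb (lam Env.two) (mu Env.two) k n (t - τ)) volume 0 t) ∧
    Summable (fun k : ℕ => ∫ τ in (0 : ℝ)..t, Real.exp (-eta Env.one * τ) *
        zeroAvoidingProb (lam Env.one) (mu Env.one) j (k + 1) τ *
        zeroAvoidingProb (lam Env.two) (mu Env.two) (k + 1) n (t - τ)) ∧
    -- the state probabilities in the second environment
    ℙ.real {ω | X t ω = (n, Env.two)} =
        (1 - p) * zeroAvoidingProb (lam Env.two) (mu Env.two) j n t +
        eta Env.one * p * ∑' k : ℕ, ∫ τ in (0 : ℝ)..t, Real.exp (-eta Env.one * τ) *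
          zeroAvoidingProb (lam Env.one) (mu Env.one) j (k + 1) τ *
          zeroAvoidingProb (lam Env.two) (mu Env.two) (k + 1) n (t - τ) ∧
    -- the simplified form of the zero-avoiding probabilities with final state `1`
    (∀ i : Env, zeroAvoidingProb (lam i) (mu i) j 1 t =
        (j : ℝ) / (mu i * t) * Real.exp (-(lam i + mu i) * t) *
          (mu i / lam i) ^ ((j : ℝ) / 2) *
          besselI (j : ℤ) (2 * t * Real.sqrt (lam i * mu i))) := by
  obtain ⟨P, hP, hfdd⟩ := hX.exists_transitionFunction
  have hlaw := measureReal_eq_of_markov ℙ hX.measurableSet_eq hfdd t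
  have ht0 : (0 : ℝ) ≤ t := t.2
  -- Needed to divide: Duhamel gives summability only of `eta Env.one` times the integrals.
  have heta_one : eta Env.one ≠ 0 := by
    rw [heta_two, add_zero] at heta_pos
    exact heta_pos.ne'
  have hsum := hP.queue_one_two hlam hmu heta heta_two hn hj ht0
  refine ⟨?_, fun k _ => ?_, (summable_mul_left_iff heta_one).1 hsum.summable, ?_, fun i =>
    zeroAvoidingProb_one_right (hlam i) (hmu i) hj (NNReal.coe_pos.2 ht)⟩
  · rw [hlaw, hP.queue_one_one hlam hmu heta heta_two hn _ ht0,
      hP.queue_two_one_eq_zero hlam hmu heta_two hn _ ht0]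
    ring
  · have h1 := continuous_zeroAvoidingProb (hlam Env.one) (hmu Env.one) j k
    have h2 := continuous_zeroAvoidingProb (hlam Env.two) (hmu Env.two) k n
    exact Continuous.intervalIntegrable (by fun_prop) _ _
  · rw [hlaw, hP.queue_two_two hlam hmu heta_two hn _ ht0, ← hsum.tsum_eq, tsum_mul_left]
    ring
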